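/- Let $\alpha$ be a probability on $\mathbb R$ with $\int\log(1+|x|)\,\alpha(dx)<\infty$. For $t>0$ let $\mu(t\alpha)$ denote the law of the mean $X_t=\int x\,P_t(dx)=\sum_{k\ge 1}W_kB_k$ of the Dirichlet random probability $P_t=\sum_{k\ge1}W_k\delta_{B_k}$ of parameter $t\alpha$. Here $Y_1,B_1,Y_2,B_2,\dots$ are independent, $B_k\sim\alpha$, $Y_k$ has density $t(1-y)^{t-1}$ on $(0,1)$, and $W_k=Y_k\prod_{j<k}(1-Y_j)$; the series converges absolutely almost surely. Let $n<m$ be positive integers such that $\mu(n\alpha)=\mu(m\alpha)$, and let $$y(z)=\int_{\mathbb R}\frac{\mu(n\alpha)(dw)}{w-z},\qquad \operatorname{Im}z>0,$$ be the Stieltjes transform of $\mu(n\alpha)$. Then for all $z$ with $\operatorname{Im}z>0$ $$\left(\frac{y^{(n-1)}(z)}{(n-1)!}\right)^m=\left(\frac{y^{(m-1)}(z)}{(m-1)!}\right)^n .$$ Moreover, if $m=n+1$ or $m=n+2$, then $\alpha$ is either a Cauchy distribution $\frac1\pi\frac{b\,dx}{(x-a)^2+b^2}$ with $a\in\mathbb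 R$, $b>0$, or a Dirac mass $\delta_a$ with $a\in\mathbb R$. -/

import Mathlib

open MeasureTheory ProbabilityTheory

namespace DirichletCurve

/-- The class of probabilities `α` on `ℝ` with `∫ log (1 + |x|) α(dx) < ∞`. -/
def FT (α : Measure ℝ) : Prop :=
  IsProbabilityMeasure α ∧ Integrable (fun x : ℝ => Real.log (1 + |x|)) α

/-- The stick-breaking weights built from `Y 0, Y 1, …` :
`W n = Y n * (1 - Y 0) * ⋯ * (1 - Y (n - 1))`. -/
noncomputable def stickWeight (Y : ℕ → ℝ) (n : ℕ) : ℝ :=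
  Y n * ∏ i ∈ Finset.range n, (1 - Y i)

/-- The joint law of the independent variables `Y 0, B 0, Y 1, B 1, …`, where every `Y n` has the
beta distribution with density `t (1 - y) ^ (t - 1)` on `(0, 1)` and every `B n` has the law `α`.
The coordinate `ω n` stands for the pair `(Y n, B n)`. -/
noncomputable def stickLaw (t : ℝ) (α : Measure ℝ) : Measure (ℕ → ℝ × ℝ) :=
  Measure.infinitePi fun _ : ℕ => (betaMeasure 1 t).prod α

/-- The mean `X = ∑ W n * B n` of the random discrete probability `P = ∑ W n • δ_(B n)`. -/
noncomputable def stickMean (ω : ℕ → ℝ × ℝ) : ℝ :=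
  ∑' n, stickWeight (fun k => (ω k).1) n * (ω n).2

/-- The law `μ(tα)` of the mean `X = ∫ x P(dx) = ∑ W n * B n` of a Dirichlet random
probability `P` with governing probability `α` and intensity `t > 0`, in its stick-breaking
representation. For `α` in the class `FT` the series converges absolutely almost surely. -/
noncomputable def dirichletMean (t : ℝ) (α : Measure ℝ) : Measure ℝ :=
  (stickLaw t α).map stickMean

/-- The Stieltjes transform `y(z) = ∫ ν(dw) / (w - z)`, to be used for `0 < Im z`. -/
noncomputable def stieltjes (ν : Measure ℝ) (z : ℂ) : ℂ :=
  ∫ w : ℝ, 1 / ((w : ℂ) - z) ∂ν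

/-- `α` is a Cauchy distribution `π⁻¹ b dx / ((x - a) ^ 2 + b ^ 2)` with `b > 0`, or a Dirac
mass. -/
def IsCauchyOrDirac (α : Measure ℝ) : Prop :=
  (∃ (a : ℝ) (b : NNReal), 0 < b ∧ α = cauchyMeasure a b) ∨ ∃ a : ℝ, α = Measure.dirac a

end DirichletCurve

open MeasureTheory ProbabilityTheory

namespace DirichletCurve

/-! Splitting off the first stick shows that the mean satisfies X ~ Y B + (1 - Y) X with independent
terms on the right. Write R_k for the k-th resolvent moment of ν = μ(nα), S for the Stieltjes
transform of α, and p = exp ∫ log(w - z) α(dw). Averaging (w - z)⁻⁽ⁿ⁺¹⁾ over the beta variable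
factorises it (`integral_feynman`), so R_{n+1} = R_n S. Since R_n' = n R_{n+1} and p' = -S p, the
product R_n pⁿ is a nonzero constant C (`exists_resolventMoment_mul_pow_eq`).

If ν is also μ(mα), then R_m pᵐ is a constant D as well. Eliminating p makes R_nᵐ and R_mⁿ
proportional, and their common behaviour at i∞ makes them equal.

For m = n + 1, S p = D / C at once. For m = n + 2, q = S p solves p q' = (n + 1)(D / C - q²); a
first integral and the growth of p force q to be constant. In both cases p is affine, S(z) = 1 / (A
- z), and Stieltjes inversion identifies α (`isCauchyOrDirac_of_resolventMoment`). -/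

/-! ### The beta law with parameters 1 and n. -/

lemma beta_one_natCast {n : ℕ} (hn : 0 < n) : ProbabilityTheory.beta 1 n = 1 / n := by
  have h : (0 : ℝ) < n := by exact_mod_cast hn
  rw [ProbabilityTheory.beta, Real.Gamma_one, add_comm, Real.Gamma_add_one h.ne']
  have := (Real.Gamma_pos_of_pos h).ne'
  field_simp

lemma betaPDFReal_one_natCast {n : ℕ} (hn : 0 < n) :
    betaPDFReal 1 n = (Set.Ioo (0 : ℝ) 1).indicator (fun y => n * (1 - y) ^ (n - 1)) := by
  ext y
  by_cases hy : 0 < y ∧ y < 1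
  · rw [betaPDFReal, if_pos hy, Set.indicator_of_mem (show y ∈ Set.Ioo (0 : ℝ) 1 from hy),
      beta_one_natCast hn, show (n : ℝ) - 1 = ((n - 1 : ℕ) : ℝ) by push_cast [hn]; ring,
      Real.rpow_natCast]
    simp
  · rw [betaPDFReal, if_neg hy, Set.indicator_of_notMem (show y ∉ Set.Ioo (0 : ℝ) 1 from hy)]

lemma integral_betaMeasure_one_natCast {E : Type*} [NormedAddCommGroup E] [NormedSpace ℝ E]
    {n : ℕ} (hn : 0 < n) (f : ℝ → E) :
    ∫ y, f y ∂(betaMeasure 1 n) = ∫ y in (0 : ℝ)..1, ((n : ℝ) * (1 - y) ^ (n - 1)) • f y := by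
  have hpos : 0 ≤ betaPDFReal 1 n := by
    rw [betaPDFReal_one_natCast hn]
    refine Set.indicator_nonneg fun y hy => ?_
    have : 0 ≤ 1 - y := by linarith [hy.2]
    positivity
  have hm : Measurable (betaPDF 1 n) := (measurable_betaPDFReal 1 n).ennreal_ofReal
  rw [betaMeasure, integral_withDensity_eq_integral_toReal_smul hm (Filter.Eventually.of_forall fun _ => by
      simp [betaPDF])]
  rw [intervalIntegral.integral_of_le zero_le_one, integral_Ioc_eq_integral_Ioo,
    ← integral_indicator measurableSet_Ioo]
  refine integral_congr_ae (Filter.Eventually.of_forall fun y => ?_)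
  simp only [betaPDF, ENNReal.toReal_ofReal (hpos y)]
  rw [betaPDFReal_one_natCast hn]
  by_cases hy : y ∈ Set.Ioo (0 : ℝ) 1 <;> simp [hy]

lemma ae_mem_Ioo_betaMeasure_one {n : ℕ} (hn : 0 < n) :
    ∀ᵐ y ∂(betaMeasure 1 n), y ∈ Set.Ioo (0 : ℝ) 1 := by
  have hm : Measurable (betaPDF 1 n) := (measurable_betaPDFReal 1 n).ennreal_ofReal
  rw [betaMeasure, ae_withDensity_iff hm]
  refine Filter.Eventually.of_forall fun y hy => ?_
  by_contra h
  exact hy (by rw [betaPDF, betaPDFReal_one_natCast hn, Set.indicator_of_notMem h]; simp)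

instance isProbabilityMeasure_betaMeasure_one {n : ℕ} [NeZero n] :
    IsProbabilityMeasure (betaMeasure 1 n) :=
  isProbabilityMeasureBeta one_pos (by exact_mod_cast Nat.pos_of_neZero n)

lemma integrable_one_sub_betaMeasure_one {n : ℕ} [NeZero n] :
    Integrable (fun y : ℝ => 1 - y) (betaMeasure 1 n) := by
  refine Integrable.of_bound (C := 1) (by fun_prop) ?_
  filter_upwards [ae_mem_Ioo_betaMeasure_one (Nat.pos_of_neZero n)] with y hy
  rw [Real.norm_eq_abs, abs_le]
  constructor <;> linarith [hy.1, hy.2]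

lemma integral_one_sub_betaMeasure_one {n : ℕ} (hn : 0 < n) :
    ∫ y, (1 - y) ∂(betaMeasure 1 n) = n / (n + 1) := by
  rw [integral_betaMeasure_one_natCast hn]
  have h (y : ℝ) : ((n : ℝ) * (1 - y) ^ (n - 1)) • (1 - y) = n * (1 - y) ^ n := by
    rw [smul_eq_mul, mul_assoc, ← pow_succ, Nat.sub_add_cancel hn]
  simp_rw [h]
  rw [intervalIntegral.integral_const_mul,
    intervalIntegral.integral_comp_sub_left (fun y => y ^ n) 1]
  simp [integral_pow]
  ring

/-! ### Stick-breaking: almost sure convergence and the distributional fixed point. -/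

/-- Prepend a term to a sequence. -/
def seqCons {E : Type*} (p : E × (ℕ → E)) : ℕ → E
  | 0 => p.1
  | k + 1 => p.2 k

lemma measurable_seqCons {E : Type*} [MeasurableSpace E] :
    Measurable (seqCons : E × (ℕ → E) → ℕ → E) := by
  refine measurable_pi_iff.2 fun k => ?_
  cases k with
  | zero => exact measurable_fst
  | succ k => exact (measurable_pi_apply k).comp measurable_snd

lemma map_seqCons_infinitePi {E : Type*} [MeasurableSpace E] (μ : Measure E)
    [IsProbabilityMeasure μ] :
    (μ.prod (Measure.infinitePi fun _ : ℕ => μ)).map seqCons = Measure.infinitePi fun _ => μ := by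
  refine Measure.eq_infinitePi _ fun s t ht => ?_
  classical
  obtain ⟨N, hN⟩ := s.exists_nat_subset_range
  -- Padding with `univ` turns the cylinder over `s` into one over an initial segment, whose
  -- preimage under `seqCons` is a product.
  set u : ℕ → Set E := fun i => if i ∈ s then t i else Set.univ with hu
  have hum (i) : MeasurableSet (u i) := by
    by_cases h : i ∈ s <;> simp [hu, h, ht]
  have h1 : Set.pi (s : Set ℕ) t = Set.pi (Finset.range (N + 1) : Set ℕ) u := by
    ext x
    simp only [Set.mem_pi, Finset.mem_coe, hu]
    constructor
    · intro h i _
      by_cases hi : i ∈ s <;> simp [hi, h]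
    · intro h i hi
      have := h i (Finset.range_mono (Nat.le_succ N) (hN hi))
      simpa [hi] using this
  have h2 : ∏ i ∈ s, μ (t i) = ∏ i ∈ Finset.range (N + 1), μ (u i) := by
    rw [← Finset.prod_subset (hN.trans (Finset.range_mono (Nat.le_succ N)))]
    · exact Finset.prod_congr rfl fun i hi => by simp [hu, hi]
    · intro i _ hi
      simp [hu, hi]
  have h3 : seqCons ⁻¹' (Set.pi (Finset.range (N + 1) : Set ℕ) u) =
      u 0 ×ˢ Set.pi (Finset.range N : Set ℕ) (fun k => u (k + 1)) := by
    ext p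
    simp only [Set.mem_preimage, Set.mem_pi, Finset.mem_coe, Finset.mem_range, Set.mem_prod]
    constructor
    · exact fun h => ⟨h 0 (by omega), fun k hk => h (k + 1) (by omega)⟩
    · rintro ⟨h, h'⟩ (_ | k) hk
      · exact h
      · exact h' k (by omega)
  rw [h1, h2, Measure.map_apply measurable_seqCons
    (MeasurableSet.pi (Finset.countable_toSet _) fun i _ => hum i), h3, Measure.prod_prod,
    Measure.infinitePi_pi _ (fun i _ => hum _), Finset.prod_range_succ', mul_comm]

section stick

variable {n : ℕ} [NeZero n] {α : Measure ℝ} [IsProbabilityMeasure α]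

instance : IsProbabilityMeasure (stickLaw n α) := by
  unfold stickLaw; infer_instance

lemma map_seqCons_stickLaw :
    ((((betaMeasure 1 n).prod α)).prod (stickLaw n α)).map seqCons = stickLaw n α :=
  map_seqCons_infinitePi _

lemma ae_stickLaw_coord {P : ℝ × ℝ → Prop} (h : ∀ᵐ p ∂((betaMeasure 1 n).prod α), P p) :
    ∀ᵐ ω ∂(stickLaw n α), ∀ k, P (ω k) := by
  rw [ae_all_iff]
  intro k
  exact (measurePreserving_eval_infinitePi
    (fun _ : ℕ => (betaMeasure 1 n).prod α) k).quasiMeasurePreserving.ae h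

lemma ae_stickLaw_mem_Ioo : ∀ᵐ ω ∂(stickLaw n α), ∀ k, (ω k).1 ∈ Set.Ioo (0 : ℝ) 1 :=
  ae_stickLaw_coord (P := fun p => p.1 ∈ Set.Ioo (0 : ℝ) 1)
    (Measure.quasiMeasurePreserving_fst.ae (ae_mem_Ioo_betaMeasure_one (Nat.pos_of_neZero n)))

lemma lintegral_prod_one_sub_stickLaw (N : ℕ) :
    ∫⁻ ω, ∏ i ∈ Finset.range N, ENNReal.ofReal (1 - (ω i).1) ∂(stickLaw n α) =
      ENNReal.ofReal (n / (n + 1)) ^ N := by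
  induction N with
  | zero => simp
  | succ N ih =>
    have hm (N : ℕ) : Measurable fun ω : ℕ → ℝ × ℝ =>
        ∏ i ∈ Finset.range N, ENNReal.ofReal (1 - (ω i).1) := by fun_prop
    rw [← map_seqCons_stickLaw, lintegral_map (hm _) measurable_seqCons]
    simp_rw [Finset.prod_range_succ']
    have h : ∫⁻ p : (ℝ × ℝ) × (ℕ → ℝ × ℝ), (∏ k ∈ Finset.range N,
        ENNReal.ofReal (1 - (seqCons p (k + 1)).1)) * ENNReal.ofReal (1 - (seqCons p 0).1)
          ∂(((betaMeasure 1 n).prod α).prod (stickLaw n α)) =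
        ∫⁻ p : (ℝ × ℝ) × (ℕ → ℝ × ℝ), ENNReal.ofReal (1 - p.1.1) * (∏ k ∈ Finset.range N,
        ENNReal.ofReal (1 - (p.2 k).1)) ∂(((betaMeasure 1 n).prod α).prod (stickLaw n α)) :=
      lintegral_congr fun p => mul_comm _ _
    have h1 : ∫⁻ p : ℝ × ℝ, ENNReal.ofReal (1 - p.1) ∂((betaMeasure 1 n).prod α) =
        ENNReal.ofReal (n / (n + 1)) := by
      rw [lintegral_prod _ (by fun_prop)]
      simp only [lintegral_const, measure_univ, mul_one]
      rw [← integral_one_sub_betaMeasure_one (Nat.pos_of_neZero n),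
        ofReal_integral_eq_lintegral_ofReal integrable_one_sub_betaMeasure_one]
      filter_upwards [ae_mem_Ioo_betaMeasure_one (Nat.pos_of_neZero n)] with y hy
      simpa using hy.2.le
    rw [h, lintegral_prod_mul (f := fun p : ℝ × ℝ => ENNReal.ofReal (1 - p.1)) (by fun_prop)
      (hm N).aemeasurable, ih, h1, pow_succ, mul_comm]

/-- The expected remaining stick is (n / (n + 1))ᵏ, so the expectation of the whole series is a
convergent geometric series. -/
lemma ae_summable_geometric_prod_one_sub {r : ℝ} (hr : (n : ℝ) / (n + 1) < r) :
    ∀ᵐ ω ∂(stickLaw n α),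
      Summable fun k => (r⁻¹) ^ k * ∏ i ∈ Finset.range k, (1 - (ω i).1) := by
  have hr0 : 0 < r := lt_of_le_of_lt (by positivity) hr
  have hm (N : ℕ) : Measurable fun ω : ℕ → ℝ × ℝ =>
      ∏ i ∈ Finset.range N, ENNReal.ofReal (1 - (ω i).1) := by fun_prop
  have hfin : ∫⁻ ω, ∑' k, ENNReal.ofReal (r⁻¹ ^ k) *
      ∏ i ∈ Finset.range k, ENNReal.ofReal (1 - (ω i).1) ∂(stickLaw n α) ≠ ⊤ := by
    rw [lintegral_tsum fun k => ((hm k).const_mul _).aemeasurable]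
    simp_rw [lintegral_const_mul _ (hm _), lintegral_prod_one_sub_stickLaw]
    have hs : Summable fun k : ℕ => (r⁻¹ * (n / (n + 1) : ℝ)) ^ k := by
      refine summable_geometric_of_lt_one (by positivity) ?_
      rw [inv_mul_lt_iff₀ hr0]; simpa using hr
    have := hs.tsum_ofReal_ne_top
    convert this using 4 with k
    rw [← ENNReal.ofReal_pow (by positivity), ← ENNReal.ofReal_mul (by positivity), mul_pow]
  filter_upwards [ae_lt_top (Measurable.tsum fun k => (hm k).const_mul _) hfin,
    ae_stickLaw_mem_Ioo] with ω h1 h2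
  have h3 (k) : ENNReal.ofReal (r⁻¹ ^ k) * ∏ i ∈ Finset.range k, ENNReal.ofReal (1 - (ω i).1) =
      ENNReal.ofReal (r⁻¹ ^ k * ∏ i ∈ Finset.range k, (1 - (ω i).1)) := by
    rw [ENNReal.ofReal_mul (by positivity),
      ENNReal.ofReal_prod_of_nonneg fun i _ => by linarith [(h2 i).2]]
  simp_rw [h3] at h1
  have h4 := ENNReal.summable_toReal h1.ne
  refine h4.congr fun k => ?_
  rw [ENNReal.toReal_ofReal]
  have : 0 ≤ ∏ i ∈ Finset.range k, (1 - (ω i).1) :=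
    Finset.prod_nonneg fun i _ => by linarith [(h2 i).2]
  positivity

/-- Borel–Cantelli: the tail probabilities of log(1 + |B|) / log r⁻¹ at the integers are summable
because this variable is integrable. -/
lemma ae_eventually_abs_snd_le (hα : FT α) {r : ℝ} (hr0 : 0 < r) (hr : r < 1) :
    ∀ᵐ ω ∂(stickLaw n α), ∀ᶠ k in Filter.atTop, |(ω k).2| ≤ r⁻¹ ^ k := by
  have hl : 0 < Real.log r⁻¹ := Real.log_pos ((one_lt_inv₀ hr0).2 hr)
  have hsum : (∑' j : ℕ, α {x | Real.log (1 + |x|) / Real.log r⁻¹ ∈ Set.Ioi (j : ℝ)}) < ⊤ :=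
    -- The lemma speaks of `volume`; the explicit instance makes `α` the volume on `ℝ`.
    @tsum_prob_mem_Ioi_lt_top ℝ ⟨α⟩ ‹_› (fun x => Real.log (1 + |x|) / Real.log r⁻¹)
      (hα.2.div_const _) (fun x => div_nonneg (Real.log_nonneg (by simp)) hl.le)
  have hmp (k : ℕ) : MeasurePreserving (fun ω : ℕ → ℝ × ℝ => (ω k).2) (stickLaw n α) α :=
    measurePreserving_snd.comp
      (measurePreserving_eval_infinitePi (fun _ : ℕ => (betaMeasure 1 n).prod α) k)
  have hle (k : ℕ) : stickLaw n α {ω | r⁻¹ ^ k < |(ω k).2|} ≤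
      α {x | Real.log (1 + |x|) / Real.log r⁻¹ ∈ Set.Ioi (k : ℝ)} := by
    have hms : MeasurableSet {x : ℝ | r⁻¹ ^ k < |x|} :=
      measurableSet_lt measurable_const measurable_id.abs
    have : stickLaw n α {ω | r⁻¹ ^ k < |(ω k).2|} = α {x | r⁻¹ ^ k < |x|} :=
      (hmp k).measure_preimage hms.nullMeasurableSet
    rw [this]
    refine measure_mono fun x hx => ?_
    simp only [Set.mem_ofPred_eq, Set.mem_Ioi] at hx ⊢
    rw [lt_div_iff₀ hl, ← Real.log_pow]
    exact Real.log_lt_log (by positivity) (by linarith)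
  filter_upwards [ae_eventually_notMem
    (lt_of_le_of_lt (ENNReal.tsum_le_tsum hle) hsum).ne] with ω hω
  filter_upwards [hω] with k hk
  simpa using hk

lemma ae_summable_stick (hα : FT α) :
    ∀ᵐ ω ∂(stickLaw n α),
      Summable fun k => stickWeight (fun k => (ω k).1) k * (ω k).2 := by
  -- With r in this gap, the growth r⁻ᵏ allowed to the atoms is still beaten by the decay of the
  -- stick.
  obtain ⟨r, hr1, hr2⟩ : ∃ r : ℝ, (n : ℝ) / (n + 1) < r ∧ r < 1 :=
    exists_between ((div_lt_one (by positivity)).2 (by linarith))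
  have hr0 : 0 < r := lt_of_le_of_lt (by positivity) hr1
  filter_upwards [ae_summable_geometric_prod_one_sub (α := α) hr1,
    ae_eventually_abs_snd_le (n := n) hα hr0 hr2, ae_stickLaw_mem_Ioo] with ω h1 h2 h3
  refine Summable.of_norm_bounded_eventually_nat h1 ?_
  filter_upwards [h2] with k hk
  have hp : 0 ≤ ∏ i ∈ Finset.range k, (1 - (ω i).1) :=
    Finset.prod_nonneg fun i _ => by linarith [(h3 i).2]
  rw [stickWeight, Real.norm_eq_abs, abs_mul, abs_mul, abs_of_nonneg hp,
    abs_of_pos (h3 k).1, mul_comm]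
  refine mul_le_mul hk ?_ (mul_nonneg (h3 k).1.le hp) (by positivity)
  exact mul_le_of_le_one_left hp (h3 k).2.le

lemma aemeasurable_stickMean (hα : FT α) : AEMeasurable stickMean (stickLaw n α) := by
  refine aemeasurable_of_tendsto_metrizable_ae Filter.atTop
    (f := fun N ω => ∑ k ∈ Finset.range N, stickWeight (fun k => (ω k).1) k * (ω k).2)
    (fun N => ?_) ?_
  · unfold stickWeight
    fun_prop
  · filter_upwards [ae_summable_stick hα] with ω hω
    exact hω.hasSum.tendsto_sum_nat

lemma stickWeight_succ (Y : ℕ → ℝ) (k : ℕ) :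
    stickWeight Y (k + 1) = (1 - Y 0) * stickWeight (fun i => Y (i + 1)) k := by
  rw [stickWeight, stickWeight, Finset.prod_range_succ']
  ring

lemma stickMean_seqCons {p : (ℝ × ℝ) × (ℕ → ℝ × ℝ)}
    (h : Summable fun k => stickWeight (fun k => (p.2 k).1) k * (p.2 k).2) :
    stickMean (seqCons p) = p.1.1 * p.1.2 + (1 - p.1.1) * stickMean p.2 := by
  set a : ℕ → ℝ := fun k => stickWeight (fun k => (seqCons p k).1) k * (seqCons p k).2 with ha
  set b : ℕ → ℝ := fun k => stickWeight (fun k => (p.2 k).1) k * (p.2 k).2 with hb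
  have h0 : a 0 = p.1.1 * p.1.2 := by simp [ha, stickWeight, seqCons]
  have hab (k : ℕ) : a (k + 1) = (1 - p.1.1) * b k := by
    simp only [ha, hb]
    rw [stickWeight_succ, mul_assoc]
    rfl
  have hs : Summable a :=
    (summable_nat_add_iff 1).1 ((h.mul_left (1 - p.1.1)).congr fun k => (hab k).symm)
  change ∑' k, a k = _ + _ * ∑' k, b k
  rw [hs.tsum_eq_zero_add, h0, ← tsum_mul_left]
  simp_rw [hab]

lemma map_prod_map_of_aemeasurable {Ω Ω' E F : Type*} [MeasurableSpace Ω] [MeasurableSpace Ω']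
    [MeasurableSpace E] [MeasurableSpace F] {μ : Measure Ω} {ν : Measure Ω'} [SFinite μ] [SFinite ν]
    {f : Ω → E} {g : Ω' → F} (hf : Measurable f) (hg : AEMeasurable g ν) :
    (μ.map f).prod (ν.map g) = (μ.prod ν).map (Prod.map f g) := by
  rw [Measure.map_congr hg.ae_eq_mk, Measure.map_prod_map _ _ hf hg.measurable_mk]
  refine Measure.map_congr ?_
  filter_upwards [Measure.quasiMeasurePreserving_snd.ae hg.ae_eq_mk] with p hp
  simp [Prod.map, hp]

lemma isProbabilityMeasure_dirichletMean (hα : FT α) :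
    IsProbabilityMeasure (dirichletMean n α) :=
  Measure.isProbabilityMeasure_map (aemeasurable_stickMean hα)

/-- The law of the mean is a fixed point of the affine recursion `X ↦ Y B + (1 - Y) X`. -/
lemma dirichletMean_eq_map (hα : FT α) :
    dirichletMean n α = (((betaMeasure 1 n).prod α).prod (dirichletMean n α)).map
      (fun p => p.1.1 * p.1.2 + (1 - p.1.1) * p.2) := by
  have := isProbabilityMeasure_dirichletMean (n := n) hα
  have hX := aemeasurable_stickMean (n := n) hα
  have hX' : AEMeasurable stickMean ((((betaMeasure 1 n).prod α).prod (stickLaw n α)).map seqCons) :=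
    by rwa [map_seqCons_stickLaw]
  have h1 : ((betaMeasure 1 n).prod α).prod (dirichletMean n α) =
      (((betaMeasure 1 n).prod α).prod (stickLaw n α)).map (Prod.map id stickMean) := by
    have h : ((betaMeasure 1 n).prod α).map id = (betaMeasure 1 n).prod α := Measure.map_id
    conv_lhs => rw [dirichletMean, ← h]
    exact map_prod_map_of_aemeasurable measurable_id hX
  have h2 : AEMeasurable (Prod.map id stickMean)
      (((betaMeasure 1 n).prod α).prod (stickLaw n α)) :=
    measurable_fst.aemeasurable.prodMk (hX.comp_quasiMeasurePreserving
      Measure.quasiMeasurePreserving_snd)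
  rw [h1, AEMeasurable.map_map_of_aemeasurable (by fun_prop) h2]
  conv_lhs => rw [dirichletMean, ← map_seqCons_stickLaw,
    AEMeasurable.map_map_of_aemeasurable hX' measurable_seqCons.aemeasurable]
  refine Measure.map_congr ?_
  filter_upwards [Measure.quasiMeasurePreserving_snd.ae (ae_summable_stick (n := n) hα)] with p hp
  exact stickMean_seqCons hp

end stick

/-! ### Resolvent moments: derivatives and behaviour at i∞. -/

open Filter Topology

/-- The moment `∫ (w - z)⁻ᵏ ν(dw)` of the resolvent kernel. -/
noncomputable def resolventMoment (ν : Measure ℝ) (k : ℕ) (z : ℂ) : ℂ :=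
  ∫ w : ℝ, (((w : ℂ) - z)⁻¹) ^ k ∂ν

lemma ofReal_sub_ne_zero {z : ℂ} (hz : 0 < z.im) (w : ℝ) : (w : ℂ) - z ≠ 0 := by
  intro h
  have := congrArg Complex.im h
  simp at this
  exact hz.ne' this

lemma norm_inv_ofReal_sub_le {z : ℂ} (hz : 0 < z.im) (w : ℝ) :
    ‖((w : ℂ) - z)⁻¹‖ ≤ z.im⁻¹ := by
  rw [norm_inv]
  refine inv_anti₀ hz ?_
  calc z.im ≤ |((w : ℂ) - z).im| := by simp [abs_of_pos hz]
    _ ≤ _ := Complex.abs_im_le_norm _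

lemma measurable_inv_ofReal_sub_pow (z : ℂ) (k : ℕ) :
    Measurable fun w : ℝ => (((w : ℂ) - z)⁻¹) ^ k := by fun_prop

lemma stieltjes_eq_resolventMoment (ν : Measure ℝ) : stieltjes ν = resolventMoment ν 1 := by
  ext z
  simp [stieltjes, resolventMoment]

section resolvent

variable {ν : Measure ℝ} [IsProbabilityMeasure ν]

lemma integrable_inv_ofReal_sub_pow {z : ℂ} (hz : 0 < z.im) (k : ℕ) :
    Integrable (fun w : ℝ => (((w : ℂ) - z)⁻¹) ^ k) ν := by
  refine Integrable.of_bound (C := (z.im⁻¹) ^ k)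
    (measurable_inv_ofReal_sub_pow z k).aestronglyMeasurable
    (Eventually.of_forall fun w => ?_)
  rw [norm_pow]
  exact pow_le_pow_left₀ (norm_nonneg _) (norm_inv_ofReal_sub_le hz w) k

lemma half_lt_im_of_mem_ball {z x : ℂ} (hx : x ∈ Metric.ball z (z.im / 2)) :
    z.im / 2 < x.im := by
  have h1 : |(x - z).im| < z.im / 2 :=
    lt_of_le_of_lt (Complex.abs_im_le_norm _) (by simpa [dist_eq_norm] using hx)
  rw [Complex.sub_im, abs_lt] at h1
  linarith [h1.1]

lemma hasDerivAt_inv_sub_pow {w z : ℂ} (h : w - z ≠ 0) (k : ℕ) :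
    HasDerivAt (fun x : ℂ => ((w - x)⁻¹) ^ k) (k * ((w - z)⁻¹) ^ (k + 1)) z := by
  have h1 : HasDerivAt (fun x : ℂ => (w - x)⁻¹) (-(-1) / (w - z) ^ 2) z :=
    ((hasDerivAt_id z).const_sub w).fun_inv h
  refine (h1.fun_pow k).congr_deriv ?_
  cases k with
  | zero => simp
  | succ k =>
    simp only [Nat.add_sub_cancel]
    rw [neg_neg, one_div, ← inv_pow]
    ring

lemma hasDerivAt_resolventMoment {z : ℂ} (hz : 0 < z.im) (k : ℕ) :
    HasDerivAt (resolventMoment ν k) (k * resolventMoment ν (k + 1) z) z := by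
  have h := (hasDerivAt_integral_of_dominated_loc_of_deriv_le (μ := ν) (𝕜 := ℂ)
    (F := fun x w => (((w : ℂ) - x)⁻¹) ^ k)
    (F' := fun x w => k * (((w : ℂ) - x)⁻¹) ^ (k + 1))
    (bound := fun _ => k * ((z.im / 2)⁻¹) ^ (k + 1))
    (Metric.ball_mem_nhds z (half_pos hz))
    (Eventually.of_forall fun x => (measurable_inv_ofReal_sub_pow x k).aestronglyMeasurable)
    (integrable_inv_ofReal_sub_pow hz k)
    ((measurable_inv_ofReal_sub_pow z (k + 1)).const_mul _).aestronglyMeasurable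
    (Eventually.of_forall fun w x hx => ?_) (integrable_const _)
    (Eventually.of_forall fun w x hx => ?_)).2
  · rw [integral_const_mul] at h
    exact h
  · have hx' := half_lt_im_of_mem_ball hx
    have hx0 : 0 < x.im := (half_pos hz).trans hx'
    rw [norm_mul, norm_pow, Complex.norm_natCast]
    gcongr
    exact (norm_inv_ofReal_sub_le hx0 w).trans (inv_anti₀ (half_pos hz) hx'.le)
  · exact hasDerivAt_inv_sub_pow
      (ofReal_sub_ne_zero ((half_pos hz).trans (half_lt_im_of_mem_ball hx)) w) k

lemma isOpen_upperHalf : IsOpen {z : ℂ | 0 < z.im} :=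
  isOpen_lt continuous_const Complex.continuous_im

lemma iteratedDeriv_stieltjes (k : ℕ) {z : ℂ} (hz : 0 < z.im) :
    iteratedDeriv k (stieltjes ν) z = k.factorial * resolventMoment ν (k + 1) z := by
  induction k generalizing z with
  | zero => simp [stieltjes_eq_resolventMoment]
  | succ k ih =>
    rw [iteratedDeriv_succ]
    have h : iteratedDeriv k (stieltjes ν) =ᶠ[𝓝 z]
        fun x => k.factorial * resolventMoment ν (k + 1) x := by
      filter_upwards [isOpen_upperHalf.mem_nhds hz] with x hx using ih hx
    rw [h.deriv_eq, ((hasDerivAt_resolventMoment hz (k + 1)).const_mul _).deriv,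
      Nat.factorial_succ]
    push_cast
    ring

/-- Dominated convergence, with bound 1 because |w - iy| ≥ y. This limit is the normalisation that
excludes zero constants and fixes ratios of constants later. -/
lemma tendsto_resolventMoment_atTop (k : ℕ) :
    Tendsto (fun y : ℝ => (y * Complex.I) ^ k * resolventMoment ν k (y * Complex.I)) atTop
      (𝓝 ((-1) ^ k)) := by
  have h1 (y : ℝ) : (y * Complex.I) ^ k * resolventMoment ν k (y * Complex.I) =
      ∫ w : ℝ, (y * Complex.I * ((w : ℂ) - y * Complex.I)⁻¹) ^ k ∂ν := by
    rw [resolventMoment, ← integral_const_mul]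
    simp_rw [mul_pow]
  have h2 : ((-1 : ℂ) ^ k) = ∫ _ : ℝ, (-1 : ℂ) ^ k ∂ν := by simp
  simp_rw [h1]
  rw [h2]
  refine tendsto_integral_filter_of_dominated_convergence (fun _ => 1)
    (Eventually.of_forall fun y => by fun_prop) ?_ (integrable_const _)
    (Eventually.of_forall fun w => ?_)
  · filter_upwards [eventually_gt_atTop 0] with y hy
    refine Eventually.of_forall fun w => ?_
    rw [norm_pow]
    refine pow_le_one₀ (norm_nonneg _) ?_
    have h := norm_inv_ofReal_sub_le (z := y * Complex.I) (by simpa using hy) w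
    rw [norm_mul]
    have h3 : ‖(y * Complex.I : ℂ)‖ = y := by simp [abs_of_pos hy]
    have h4 : (y * Complex.I : ℂ).im = y := by simp
    rw [h4] at h
    rw [h3]
    calc y * _ ≤ y * y⁻¹ := by gcongr
      _ = 1 := mul_inv_cancel₀ hy.ne'
  · refine Tendsto.pow ?_ k
    have h3 : Tendsto (fun y : ℝ => (((w : ℂ) / (y : ℂ)) - Complex.I)) atTop
        (𝓝 (0 - Complex.I)) := by
      refine Tendsto.sub_const ?_ _
      have : Tendsto (fun y : ℝ => ((w / y : ℝ) : ℂ)) atTop (𝓝 ((0 : ℝ) : ℂ)) :=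
        (Complex.continuous_ofReal.tendsto 0).comp (tendsto_const_nhds.div_atTop tendsto_id)
      simpa using this
    have h4 := (h3.inv₀ (by simp)).const_mul Complex.I
    have h5 : Complex.I * (0 - Complex.I)⁻¹ = -1 := by
      rw [zero_sub, inv_neg, Complex.inv_I]; simp
    rw [h5] at h4
    refine h4.congr' ?_
    filter_upwards [eventually_gt_atTop 0] with y hy
    have hy' : (y : ℂ) ≠ 0 := by exact_mod_cast hy.ne'
    have : (w : ℂ) / y - Complex.I = (y : ℂ)⁻¹ * (w - y * Complex.I) := by
      field_simp
    rw [this, mul_inv, inv_inv]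
    ring

end resolvent

/-! ### The beta integral and the recursion for resolvent moments. -/

section recursion

/-- With E(y) = y v + (1 - y) u, the quotient (1 - y) / E has derivative -v / E², so its powers are
primitives of the beta-weighted kernel. -/
lemma hasDerivAt_feynman {u v : ℂ} {y : ℝ} {k : ℕ}
    (hD : (y : ℂ) * v + (1 - y) * u ≠ 0) :
    HasDerivAt (fun y : ℝ => ((1 - (y : ℂ)) * ((y : ℂ) * v + (1 - y) * u)⁻¹) ^ (k + 1))
      (-v * (((k + 1 : ℕ) : ℂ) * (1 - y) ^ k * (((y : ℂ) * v + (1 - y) * u)⁻¹) ^ (k + 2))) y := by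
  have hid : HasDerivAt (fun y : ℝ => (y : ℂ)) 1 y := Complex.ofRealCLM.hasDerivAt
  have h1 : HasDerivAt (fun y : ℝ => 1 - (y : ℂ)) (-1) y := hid.const_sub 1
  have h2 : HasDerivAt (fun y : ℝ => (y : ℂ) * v + (1 - y) * u) (1 * v + -1 * u) y :=
    (hid.mul_const v).add (h1.mul_const u)
  refine ((h1.fun_mul (h2.fun_inv hD)).fun_pow (k + 1)).congr_deriv ?_
  have hE := mul_inv_cancel₀ hD
  rw [div_eq_mul_inv, ← inv_pow]
  set E := ((y : ℂ) * v + (1 - y) * u)⁻¹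
  simp only [Nat.add_sub_cancel, mul_pow]
  linear_combination ((k + 1 : ℕ) : ℂ) * (1 - y) ^ k * E ^ (k + 1) * hE

lemma integral_feynman {u v : ℂ} (hu : u.im < 0) (hv : v.im < 0) {k : ℕ} (hk : 0 < k) :
    ∫ y : ℝ, (((y : ℂ) * v + (1 - y) * u)⁻¹) ^ (k + 1) ∂(betaMeasure 1 k) = v⁻¹ * (u⁻¹) ^ k := by
  obtain ⟨k, rfl⟩ : ∃ j, k = j + 1 := ⟨k - 1, by omega⟩
  have hv0 : v ≠ 0 := by rintro rfl; simp at hv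
  -- The segment from u to v stays in the open lower half-plane.
  have hD (y : ℝ) (hy : y ∈ Set.uIcc (0 : ℝ) 1) : (y : ℂ) * v + (1 - y) * u ≠ 0 := by
    rw [Set.uIcc_of_le zero_le_one] at hy
    intro h
    have h1 := congrArg Complex.im h
    have h2 : y * v.im + (1 - y) * u.im = 0 := by simpa using h1
    rcases hy.1.eq_or_lt with h0 | h0
    · subst h0; simp at h2; linarith
    · nlinarith [mul_pos h0 (neg_pos.2 hv), mul_nonneg (sub_nonneg.2 hy.2) (neg_pos.2 hu).le]
  rw [integral_betaMeasure_one_natCast hk]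
  have hc : ContinuousOn (fun y : ℝ =>
      -v * (((k + 1 : ℕ) : ℂ) * (1 - y) ^ k * (((y : ℂ) * v + (1 - y) * u)⁻¹) ^ (k + 2)))
      (Set.uIcc 0 1) := by
    refine continuousOn_const.mul (ContinuousOn.mul (by fun_prop) ((ContinuousOn.inv₀ ?_ hD).pow _))
    fun_prop
  have h := intervalIntegral.integral_eq_sub_of_hasDerivAt
    (fun y hy => hasDerivAt_feynman (k := k) (hD y hy)) hc.intervalIntegrable
  rw [intervalIntegral.integral_const_mul] at h
  have h' : ∫ y in (0 : ℝ)..1, (((k + 1 : ℕ) : ℝ) * (1 - y) ^ (k + 1 - 1)) •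
      (((y : ℂ) * v + (1 - y) * u)⁻¹) ^ (k + 1 + 1) =
      ∫ y in (0 : ℝ)..1,
        (((k + 1 : ℕ) : ℂ) * (1 - y) ^ k * (((y : ℂ) * v + (1 - y) * u)⁻¹) ^ (k + 2)) := by
    refine intervalIntegral.integral_congr fun y _ => ?_
    simp only [Complex.real_smul, Nat.add_sub_cancel]
    push_cast
    ring
  rw [h']
  have h3 : v * v⁻¹ = 1 := mul_inv_cancel₀ hv0
  simp at h
  push_cast
  simp only [inv_pow]
  linear_combination v⁻¹ * h + (-∫ y in (0 : ℝ)..1,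
        (((k : ℂ) + 1) * (1 - (y : ℂ)) ^ k * (((y : ℂ) * v + (1 - y) * u) ^ (k + 2))⁻¹)) * h3

lemma resolventMoment_succ_of_eq_map {n : ℕ} [NeZero n] {α ν : Measure ℝ}
    [IsProbabilityMeasure α] [IsProbabilityMeasure ν]
    (hmap : ν = (((betaMeasure 1 n).prod α).prod ν).map
      (fun p => p.1.1 * p.1.2 + (1 - p.1.1) * p.2)) {z : ℂ} (hz : 0 < z.im) :
    resolventMoment ν (n + 1) z = resolventMoment ν n z * resolventMoment α 1 z := by
  have hF : Measurable fun p : (ℝ × ℝ) × ℝ => p.1.1 * p.1.2 + (1 - p.1.1) * p.2 := by fun_prop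
  have hint := integrable_inv_ofReal_sub_pow (ν := ν) hz (n + 1)
  rw [hmap, integrable_map_measure (measurable_inv_ofReal_sub_pow _ _).aestronglyMeasurable
    hF.aemeasurable] at hint
  have hmp : MeasurePreserving (MeasurableEquiv.prodAssoc : (ℝ × ℝ) × ℝ ≃ᵐ ℝ × (ℝ × ℝ))
    (((betaMeasure 1 n).prod α).prod ν) ((betaMeasure 1 n).prod (α.prod ν)) :=
    measurePreserving_prodAssoc _ _ _
  let G : ℝ × (ℝ × ℝ) → ℂ := fun q =>
    (((q.1 : ℂ) * (q.2.1 - z) + (1 - q.1) * (q.2.2 - z))⁻¹) ^ (n + 1)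
  have h1 (p : (ℝ × ℝ) × ℝ) :
      (((p.1.1 * p.1.2 + (1 - p.1.1) * p.2 : ℝ) : ℂ) - z)⁻¹ ^ (n + 1) =
        G (MeasurableEquiv.prodAssoc p) := by
    simp only [G, MeasurableEquiv.prodAssoc, MeasurableEquiv.coe_mk, Equiv.prodAssoc_apply]
    congr 2
    push_cast
    ring
  have hint' : Integrable G ((betaMeasure 1 n).prod (α.prod ν)) := by
    rw [← hmp.integrable_comp_emb (MeasurableEquiv.measurableEmbedding _)]
    exact hint.congr (Eventually.of_forall h1)
  have h2 (q : ℝ × ℝ) : ∫ y, G (y, q) ∂(betaMeasure 1 n) =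
      ((q.1 : ℂ) - z)⁻¹ * (((q.2 : ℂ) - z)⁻¹) ^ n :=
    integral_feynman (u := (q.2 : ℂ) - z) (v := (q.1 : ℂ) - z) (by simpa using hz)
      (by simpa using hz) (Nat.pos_of_neZero n)
  calc resolventMoment ν (n + 1) z
      = ∫ p, (((p.1.1 * p.1.2 + (1 - p.1.1) * p.2 : ℝ) : ℂ) - z)⁻¹ ^ (n + 1)
          ∂(((betaMeasure 1 n).prod α).prod ν) := by
        rw [resolventMoment]
        conv_lhs => rw [hmap]
        exact integral_map hF.aemeasurable
          (measurable_inv_ofReal_sub_pow _ _).aestronglyMeasurable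
    _ = ∫ q, G q ∂((betaMeasure 1 n).prod (α.prod ν)) := by
        rw [← hmp.integral_comp (MeasurableEquiv.measurableEmbedding _) G]
        exact integral_congr_ae (Eventually.of_forall h1)
    _ = ∫ q : ℝ × ℝ, ((q.1 : ℂ) - z)⁻¹ * (((q.2 : ℂ) - z)⁻¹) ^ n ∂(α.prod ν) := by
        -- Integrating over the beta variable first leaves a product of a function of B and a
        -- function of X, which independence splits.
        rw [integral_prod_symm _ hint']
        exact integral_congr_ae (Eventually.of_forall h2)
    _ = (∫ x : ℝ, ((x : ℂ) - z)⁻¹ ∂α) * ∫ x : ℝ, (((x : ℂ) - z)⁻¹) ^ n ∂ν :=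
        integral_prod_mul (L := ℂ) (fun x : ℝ => ((x : ℂ) - z)⁻¹)
          (fun x : ℝ => (((x : ℂ) - z)⁻¹) ^ n)
    _ = _ := by simp only [resolventMoment, pow_one]; ring

/-- The differential equation satisfied by the resolvent moments of the law of the mean. -/
lemma resolventMoment_dirichletMean_succ {n : ℕ} [NeZero n] {α : Measure ℝ}
    [IsProbabilityMeasure α] (hα : FT α) {z : ℂ} (hz : 0 < z.im) :
    resolventMoment (dirichletMean n α) (n + 1) z =
      resolventMoment (dirichletMean n α) n z * resolventMoment α 1 z := by
  have := isProbabilityMeasure_dirichletMean (n := n) hα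
  exact resolventMoment_succ_of_eq_map (dirichletMean_eq_map hα) hz

end recursion

/-! ### Stieltjes inversion through Cauchy smoothing. -/

open scoped NNReal BoundedContinuousFunction

section inversion

lemma integral_cauchyMeasure (a : ℝ) {γ : ℝ≥0} (hγ : γ ≠ 0) (f : ℝ → ℝ) :
    ∫ x, f x ∂(cauchyMeasure a γ) = ∫ x, cauchyPDFReal a γ x * f x := by
  rw [cauchyMeasure_of_scale_ne_zero a hγ, integral_withDensity_eq_integral_toReal_smul
    (measurable_cauchyPDF a γ) (Eventually.of_forall fun _ => by simp [cauchyPDF])]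
  simp_rw [cauchyPDF, ENNReal.toReal_ofReal (cauchyPDF_pos a hγ _).le, smul_eq_mul]

lemma cauchyPDFReal_affine (a s : ℝ) {γ : ℝ≥0} (hγ : γ ≠ 0) :
    cauchyPDFReal 0 1 s = γ * cauchyPDFReal a γ (a + γ * s) := by
  have : (γ : ℝ) ≠ 0 := by exact_mod_cast hγ
  have h2 : s ^ 2 + 1 ≠ 0 := by positivity
  rw [cauchyPDFReal_def, cauchyPDFReal_def]
  have h3 : (a + γ * s - a) ^ 2 + (γ : ℝ) ^ 2 = γ ^ 2 * (s ^ 2 + 1) := by ring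
  rw [h3]
  simp
  field_simp

lemma integral_cauchyMeasure_affine (a : ℝ) {γ : ℝ≥0} (hγ : γ ≠ 0) (f : ℝ → ℝ) :
    ∫ x, f x ∂(cauchyMeasure a γ) = ∫ s, f (a + γ * s) ∂(cauchyMeasure 0 1) := by
  have hpos : (0 : ℝ) < γ := by exact_mod_cast pos_iff_ne_zero.2 hγ
  rw [integral_cauchyMeasure a hγ, integral_cauchyMeasure 0 one_ne_zero]
  simp_rw [cauchyPDFReal_affine a _ hγ, mul_assoc]
  rw [integral_const_mul,
    Measure.integral_comp_mul_left (fun t => cauchyPDFReal a γ (a + t) * f (a + t)) (γ : ℝ),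
    integral_add_left_eq_self (fun t => cauchyPDFReal a γ t * f t) a, abs_of_pos (inv_pos.2 hpos),
    smul_eq_mul, ← mul_assoc, mul_inv_cancel₀ hpos.ne', one_mul]

lemma im_inv_ofReal_sub (w x : ℝ) (γ : ℝ≥0) :
    Real.pi⁻¹ * (((w : ℂ) - (x + γ * Complex.I))⁻¹).im = cauchyPDFReal w γ x := by
  rw [Complex.inv_im, cauchyPDFReal_def, Complex.normSq_apply]
  simp
  ring_nf

variable {α : Measure ℝ} [IsProbabilityMeasure α]

lemma im_resolventMoment {γ : ℝ≥0} (hγ : γ ≠ 0) (x : ℝ) :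
    Real.pi⁻¹ * (resolventMoment α 1 (x + γ * Complex.I)).im = ∫ w, cauchyPDFReal w γ x ∂α := by
  have hz : 0 < ((x : ℂ) + γ * Complex.I).im := by simpa using pos_iff_ne_zero.2 hγ
  have h := Complex.imCLM.integral_comp_comm (integrable_inv_ofReal_sub_pow (ν := α) hz 1)
  simp only [Complex.imCLM_apply, pow_one] at h
  simp_rw [resolventMoment, pow_one, ← h, ← integral_const_mul, im_inv_ofReal_sub]

/-- Fubini: the convolution of α with a Cauchy law of scale γ has density π⁻¹ Im S(x + iγ). -/
lemma integral_cauchyMeasure_mixture {γ : ℝ≥0} (hγ : γ ≠ 0) (f : ℝ →ᵇ ℝ) :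
    ∫ w, ∫ x, f x ∂(cauchyMeasure w γ) ∂α =
      ∫ x : ℝ, (Real.pi⁻¹ * (resolventMoment α 1 (x + γ * Complex.I)).im) * f x := by
  have hm : Measurable fun q : ℝ × ℝ => cauchyPDFReal q.1 γ q.2 := by
    unfold cauchyPDFReal; fun_prop
  have hK : Integrable (fun q : ℝ × ℝ => cauchyPDFReal q.1 γ q.2) (α.prod volume) := by
    rw [integrable_prod_iff hm.aestronglyMeasurable]
    refine ⟨Eventually.of_forall fun w => integrable_cauchyPDFReal w, ?_⟩
    simp_rw [Real.norm_of_nonneg (cauchyPDF_pos _ hγ _).le, integral_cauchyPDFReal_eq_one _ hγ]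
    exact integrable_const _
  have hKf : Integrable (Function.uncurry fun w x : ℝ => cauchyPDFReal w γ x * f x)
      (α.prod volume) :=
    hK.mul_bdd (c := ‖f‖) (f.continuous.measurable.comp measurable_snd).aestronglyMeasurable
      (Eventually.of_forall fun q => f.norm_coe_le_norm q.2)
  simp_rw [integral_cauchyMeasure _ hγ, im_resolventMoment hγ, ← integral_mul_const]
  exact integral_integral_swap hKf

/-- Writing the mixture as the law of w + γ s, with s standard Cauchy, makes the limit γ → 0 a
dominated convergence; it recovers α from its transform. -/
lemma tendsto_integral_cauchyMeasure_mixture (f : ℝ →ᵇ ℝ) :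
    Tendsto (fun γ : ℝ≥0 => ∫ w, ∫ x, f x ∂(cauchyMeasure w γ) ∂α) (𝓝[≠] 0)
      (𝓝 (∫ w, f w ∂α)) := by
  have h : Tendsto (fun γ : ℝ≥0 => ∫ q : ℝ × ℝ, f (q.1 + γ * q.2) ∂(α.prod (cauchyMeasure 0 1)))
      (𝓝[≠] 0) (𝓝 (∫ q : ℝ × ℝ, f q.1 ∂(α.prod (cauchyMeasure 0 1)))) := by
    refine tendsto_integral_filter_of_dominated_convergence (fun _ => ‖f‖)
      (Eventually.of_forall fun γ => (f.continuous.comp (by fun_prop)).aestronglyMeasurable)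
      (Eventually.of_forall fun γ => Eventually.of_forall fun q => f.norm_coe_le_norm _)
      (integrable_const _) (Eventually.of_forall fun q => ?_)
    have : Continuous fun γ : ℝ≥0 => f (q.1 + γ * q.2) := f.continuous.comp (by fun_prop)
    have h0 := (this.tendsto 0).mono_left (nhdsWithin_le_nhds (s := {0}ᶜ))
    simpa using h0
  rw [integral_fun_fst (fun x => f x)] at h
  simp only [probReal_univ, one_smul] at h
  refine h.congr' ?_
  filter_upwards [self_mem_nhdsWithin] with γ hγ
  rw [integral_prod]
  · exact integral_congr_ae (Eventually.of_forall fun w =>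
      (integral_cauchyMeasure_affine w hγ f).symm)
  · exact Integrable.of_bound (C := ‖f‖)
      (f.continuous.comp (by fun_prop)).aestronglyMeasurable
      (Eventually.of_forall fun q => f.norm_coe_le_norm _)

lemma tendsto_integral_cauchyMeasure_scale (a : ℝ) (b : ℝ≥0) (f : ℝ →ᵇ ℝ) :
    Tendsto (fun γ : ℝ≥0 => ∫ x, f x ∂(cauchyMeasure a (b + γ))) (𝓝[≠] 0)
      (𝓝 (∫ s, f (a + b * s) ∂(cauchyMeasure 0 1))) := by
  have h : Tendsto (fun γ : ℝ≥0 => ∫ s, f (a + ((b + γ : ℝ≥0) : ℝ) * s) ∂(cauchyMeasure 0 1))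
      (𝓝[≠] 0) (𝓝 (∫ s, f (a + b * s) ∂(cauchyMeasure 0 1))) := by
    refine tendsto_integral_filter_of_dominated_convergence (fun _ => ‖f‖)
      (Eventually.of_forall fun γ => (f.continuous.comp (by fun_prop)).aestronglyMeasurable)
      (Eventually.of_forall fun γ => Eventually.of_forall fun q => f.norm_coe_le_norm _)
      (integrable_const _) (Eventually.of_forall fun s => ?_)
    have : Continuous fun γ : ℝ≥0 => f (a + ((b + γ : ℝ≥0) : ℝ) * s) :=
      f.continuous.comp (by fun_prop)
    have h0 := (this.tendsto 0).mono_left (nhdsWithin_le_nhds (s := {0}ᶜ))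
    simpa using h0
  refine h.congr' ?_
  filter_upwards [self_mem_nhdsWithin] with γ hγ
  exact (integral_cauchyMeasure_affine a (by simp_all) f).symm

/-- A probability whose Stieltjes transform is `z ↦ (A - z)⁻¹` is Cauchy or Dirac. -/
lemma isCauchyOrDirac_of_resolventMoment {A : ℂ}
    (h : ∀ z : ℂ, 0 < z.im → resolventMoment α 1 z * (A - z) = 1) : IsCauchyOrDirac α := by
  -- Otherwise z = A is admissible and the hypothesis reads 0 = 1.
  have hA : A.im ≤ 0 := by
    by_contra! hA
    simpa using h A hA
  obtain ⟨b, hb⟩ : ∃ b : ℝ≥0, (b : ℝ) = -A.im := ⟨⟨-A.im, by linarith⟩, rfl⟩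
  have hAe : A = (A.re : ℂ) - b * Complex.I := by
    apply Complex.ext <;> simp [hb]
  have hS (γ : ℝ≥0) (hγ : γ ≠ 0) (x : ℝ) :
      Real.pi⁻¹ * (resolventMoment α 1 (x + γ * Complex.I)).im =
        cauchyPDFReal A.re (b + γ) x := by
    have hz : 0 < ((x : ℂ) + γ * Complex.I).im := by simpa using pos_iff_ne_zero.2 hγ
    rw [eq_inv_of_mul_eq_one_left (h _ hz), ← im_inv_ofReal_sub]
    congr 3
    conv_lhs => rw [hAe]
    push_cast
    ring
  -- Smoothing α at scale γ gives the Cauchy law of scale b + γ; both descriptions pass to the limit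
  -- γ → 0.
  have hf (f : ℝ →ᵇ ℝ) : ∫ w, f w ∂α = ∫ s, f (A.re + b * s) ∂(cauchyMeasure 0 1) := by
    refine tendsto_nhds_unique (tendsto_integral_cauchyMeasure_mixture f)
      ((tendsto_integral_cauchyMeasure_scale A.re b f).congr' ?_)
    filter_upwards [self_mem_nhdsWithin] with γ hγ
    rw [integral_cauchyMeasure_mixture hγ, integral_cauchyMeasure _ (fun h => hγ (add_eq_zero.1 h).2)]
    simp_rw [hS γ hγ]
  by_cases hb0 : b = 0
  · refine Or.inr ⟨A.re, ext_of_forall_integral_eq_of_IsFiniteMeasure fun f => ?_⟩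
    rw [hf f]
    simp [hb0]
  · refine Or.inl ⟨A.re, b, pos_iff_ne_zero.2 hb0,
      ext_of_forall_integral_eq_of_IsFiniteMeasure fun f => ?_⟩
    rw [hf f, integral_cauchyMeasure_affine _ hb0]

end inversion

/-! ### The logarithmic potential and the differential equations. -/

section potential

variable {α : Measure ℝ}

/-- The exponential of the logarithmic potential `∫ log (w - z) α(dw)`. -/
noncomputable def expLogPotential (α : Measure ℝ) (z : ℂ) : ℂ :=
  Complex.exp (∫ w : ℝ, Complex.log ((w : ℂ) - z) ∂α)

lemma expLogPotential_ne_zero (z : ℂ) : expLogPotential α z ≠ 0 := Complex.exp_ne_zero _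

lemma integrable_log_ofReal_sub (hα : FT α) {z : ℂ} (hz : 0 < z.im) :
    Integrable (fun w : ℝ => Complex.log ((w : ℂ) - z)) α := by
  have := hα.1
  have hm : Measurable fun w : ℝ => Complex.log ((w : ℂ) - z) :=
    Complex.measurable_log.comp (by fun_prop)
  refine Integrable.mono' (g := fun w : ℝ => Real.log (1 + |w|) +
    (Real.log (1 + ‖z‖) + |Real.log z.im| + Real.pi)) (hα.2.add (integrable_const _))
    hm.aestronglyMeasurable (Eventually.of_forall fun w => ?_)
  have h1 : z.im ≤ ‖(w : ℂ) - z‖ := by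
    calc z.im ≤ |((w : ℂ) - z).im| := by simp [abs_of_pos hz]
      _ ≤ _ := Complex.abs_im_le_norm _
  have h2 : ‖(w : ℂ) - z‖ ≤ (1 + |w|) * (1 + ‖z‖) := by
    have := norm_sub_le (w : ℂ) z
    rw [Complex.norm_real, Real.norm_eq_abs] at this
    nlinarith [abs_nonneg w, norm_nonneg z, mul_nonneg (abs_nonneg w) (norm_nonneg z)]
  have h3 := Real.log_le_log hz h1
  have h4 := Real.log_le_log (hz.trans_le h1) h2
  rw [Real.log_mul (by positivity) (by positivity)] at h4
  have h5 : 0 ≤ Real.log (1 + |w|) := Real.log_nonneg (by simp)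
  have h6 : 0 ≤ Real.log (1 + ‖z‖) := Real.log_nonneg (by simp)
  have h7 : |Real.log ‖(w : ℂ) - z‖| ≤
      Real.log (1 + |w|) + Real.log (1 + ‖z‖) + |Real.log z.im| := by
    rw [abs_le]
    constructor <;> linarith [neg_abs_le (Real.log z.im), abs_nonneg (Real.log z.im)]
  have h8 := Complex.norm_le_abs_re_add_abs_im (Complex.log ((w : ℂ) - z))
  rw [Complex.log_re, Complex.log_im] at h8
  linarith [Complex.abs_arg_le_pi ((w : ℂ) - z)]

lemma hasDerivAt_expLogPotential (hα : FT α) {z : ℂ} (hz : 0 < z.im) :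
    HasDerivAt (expLogPotential α) (-(resolventMoment α 1 z * expLogPotential α z)) z := by
  have := hα.1
  have h := (hasDerivAt_integral_of_dominated_loc_of_deriv_le (μ := α) (𝕜 := ℂ)
    (F := fun x w => Complex.log ((w : ℂ) - x))
    (F' := fun x w => -(((w : ℂ) - x)⁻¹) ^ 1)
    (bound := fun _ => (z.im / 2)⁻¹)
    (Metric.ball_mem_nhds z (half_pos hz))
    (Eventually.of_forall fun x =>
      (Complex.measurable_log.comp (by fun_prop)).aestronglyMeasurable)
    (integrable_log_ofReal_sub hα hz)
    (measurable_inv_ofReal_sub_pow z 1).neg.aestronglyMeasurable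
    (Eventually.of_forall fun w x hx => ?_) (integrable_const _)
    (Eventually.of_forall fun w x hx => ?_)).2
  · rw [integral_neg] at h
    exact h.cexp.congr_deriv (by rw [expLogPotential, resolventMoment]; ring)
  · have hx' := half_lt_im_of_mem_ball hx
    rw [norm_neg, pow_one]
    exact (norm_inv_ofReal_sub_le ((half_pos hz).trans hx') w).trans
      (inv_anti₀ (half_pos hz) hx'.le)
  · have hx0 : 0 < x.im := (half_pos hz).trans (half_lt_im_of_mem_ball hx)
    have h1 : HasDerivAt (fun x : ℂ => (w : ℂ) - x) (-1) x := (hasDerivAt_id x).const_sub _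
    refine (h1.clog (Or.inr (by simpa using hx0.ne'))).congr_deriv ?_
    rw [pow_one, neg_div, one_div]

lemma exists_eq_const_of_hasDerivAt_zero {g : ℂ → ℂ}
    (h : ∀ z : ℂ, 0 < z.im → HasDerivAt g 0 z) : ∃ c, ∀ z : ℂ, 0 < z.im → g z = c := by
  obtain ⟨c, hc⟩ := isOpen_upperHalf.exists_is_const_of_deriv_eq_zero
    (convex_halfSpace_im_gt 0).isPreconnected
    (fun z hz => (h z hz).differentiableAt.differentiableWithinAt) (fun z hz => (h z hz).deriv)
  exact ⟨c, fun z hz => hc z hz⟩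

lemma im_ofReal_mul_I_pos {y : ℝ} (hy : 0 < y) : 0 < ((y : ℂ) * Complex.I).im := by simpa using hy

/-- The derivatives k S R_k and -k S pᵏ of the two factors cancel in the product rule. A zero
constant would make R_k vanish on the imaginary axis, against its limit. -/
lemma exists_resolventMoment_mul_pow_eq (hα : FT α) {ν : Measure ℝ} [IsProbabilityMeasure ν]
    {k : ℕ} (hrec : ∀ z : ℂ, 0 < z.im →
      resolventMoment ν (k + 1) z = resolventMoment ν k z * resolventMoment α 1 z) :
    ∃ C : ℂ, C ≠ 0 ∧ ∀ z : ℂ, 0 < z.im →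
      resolventMoment ν k z * expLogPotential α z ^ k = C := by
  obtain ⟨C, hC⟩ := exists_eq_const_of_hasDerivAt_zero
    (g := fun z => resolventMoment ν k z * expLogPotential α z ^ k) fun z hz => by
      refine ((hasDerivAt_resolventMoment hz k).fun_mul
        ((hasDerivAt_expLogPotential hα hz).fun_pow k)).congr_deriv ?_
      rw [hrec z hz]
      cases k with
      | zero => simp
      | succ k => simp only [Nat.add_sub_cancel]; ring
  refine ⟨C, ?_, hC⟩
  rintro rfl
  have h := tendsto_resolventMoment_atTop (ν := ν) k
  have h0 : Tendsto (fun y : ℝ => (y * Complex.I) ^ k * resolventMoment ν k (y * Complex.I)) atTop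
      (𝓝 0) := by
    refine tendsto_const_nhds.congr' ?_
    filter_upwards [eventually_gt_atTop 0] with y hy
    have := hC _ (im_ofReal_mul_I_pos hy)
    rw [(mul_eq_zero.1 this).resolve_right (pow_ne_zero _ (expLogPotential_ne_zero _)), mul_zero]
  exact pow_ne_zero k (by norm_num : (-1 : ℂ) ≠ 0) (tendsto_nhds_unique h h0)

lemma resolventMoment_pow_eq_pow (hα : FT α) {ν : Measure ℝ} [IsProbabilityMeasure ν] {n m : ℕ}
    (hn : ∀ z : ℂ, 0 < z.im →
      resolventMoment ν (n + 1) z = resolventMoment ν n z * resolventMoment α 1 z)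
    (hm : ∀ z : ℂ, 0 < z.im →
      resolventMoment ν (m + 1) z = resolventMoment ν m z * resolventMoment α 1 z)
    {z : ℂ} (hz : 0 < z.im) : resolventMoment ν n z ^ m = resolventMoment ν m z ^ n := by
  obtain ⟨C, hC0, hC⟩ := exists_resolventMoment_mul_pow_eq hα hn
  obtain ⟨D, hD0, hD⟩ := exists_resolventMoment_mul_pow_eq hα hm
  have key (z : ℂ) (hz : 0 < z.im) :
      resolventMoment ν n z ^ m * D ^ n = resolventMoment ν m z ^ n * C ^ m := by
    rw [← hC z hz, ← hD z hz]
    ring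
  -- After multiplication by (iy)ⁿᵐ, both moment powers tend to (-1)ⁿᵐ, so the constants must agree.
  have hCD : D ^ n = C ^ m := by
    have h1 := ((tendsto_resolventMoment_atTop (ν := ν) n).pow m).mul_const (D ^ n)
    have h2 := ((tendsto_resolventMoment_atTop (ν := ν) m).pow n).mul_const (C ^ m)
    have h3 := tendsto_nhds_unique (h1.congr' ?_) h2
    · rw [← pow_mul, ← pow_mul, mul_comm m n] at h3
      exact mul_left_cancel₀ (pow_ne_zero _ (by norm_num)) h3
    · filter_upwards [eventually_gt_atTop 0] with y hy
      have := key _ (im_ofReal_mul_I_pos hy)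
      linear_combination ((y : ℂ) * Complex.I) ^ (n * m) * this
  have h := key z hz
  rw [hCD] at h
  exact mul_right_cancel₀ (pow_ne_zero _ hC0) h

/-- The hypothesis says p' = -c, so p(z) = d - c z and S = c / p has the form (A - z)⁻¹ with A = d /
c. -/
lemma isCauchyOrDirac_of_mul_eq_const (hα : FT α) {c : ℂ}
    (h : ∀ z : ℂ, 0 < z.im → resolventMoment α 1 z * expLogPotential α z = c) :
    IsCauchyOrDirac α := by
  have := hα.1
  have hc : c ≠ 0 := by
    rintro rfl
    have h1 := tendsto_resolventMoment_atTop (ν := α) 1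
    have h0 : Tendsto (fun y : ℝ => (y * Complex.I) ^ 1 * resolventMoment α 1 (y * Complex.I))
        atTop (𝓝 0) := by
      refine tendsto_const_nhds.congr' ?_
      filter_upwards [eventually_gt_atTop 0] with y hy
      rw [(mul_eq_zero.1 (h _ (im_ofReal_mul_I_pos hy))).resolve_right
        (expLogPotential_ne_zero _), mul_zero]
    simpa using tendsto_nhds_unique h1 h0
  obtain ⟨d, hd⟩ := exists_eq_const_of_hasDerivAt_zero
    (g := fun z => expLogPotential α z + c * z) fun z hz => by
      refine ((hasDerivAt_expLogPotential hα hz).fun_add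
        ((hasDerivAt_id z).const_mul c)).congr_deriv ?_
      rw [h z hz]; simp
  refine isCauchyOrDirac_of_resolventMoment (A := d / c) fun z hz => ?_
  have h1 := h z hz
  have h2 := hd z hz
  have h3 : expLogPotential α z = c * (d / c - z) := by
    rw [mul_sub, mul_div_cancel₀ _ hc, ← h2]; ring
  rw [h3] at h1
  apply mul_left_cancel₀ hc
  rw [mul_one]
  linear_combination h1

/-- Since |R_k| |p|ᵏ is constant and |R_k(iy)| decays like y⁻ᵏ, |p(iy)| grows linearly; the limit is
a k-th root of |C|. -/
lemma tendsto_norm_expLogPotential_div (hα : FT α) {ν : Measure ℝ} [IsProbabilityMeasure ν]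
    {k : ℕ} (hk : 0 < k) (hrec : ∀ z : ℂ, 0 < z.im →
      resolventMoment ν (k + 1) z = resolventMoment ν k z * resolventMoment α 1 z) :
    ∃ L : ℝ, 0 < L ∧
      Tendsto (fun y : ℝ => ‖expLogPotential α (y * Complex.I)‖ / y) atTop (𝓝 L) := by
  obtain ⟨C, hC0, hC⟩ := exists_resolventMoment_mul_pow_eq hα hrec
  have h := ((tendsto_resolventMoment_atTop (ν := ν) k).norm.inv₀ (by simp)).const_mul ‖C‖
  have h1 := h.rpow_const (p := (k : ℝ)⁻¹) (Or.inr (by positivity))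
  refine ⟨_, ?_, h1.congr' ?_⟩
  · have : 0 < ‖C‖ := norm_pos_iff.2 hC0
    simp only [norm_pow, norm_neg, norm_one, one_pow, inv_one, mul_one]
    positivity
  · filter_upwards [eventually_gt_atTop 0] with y hy
    have hz := im_ofReal_mul_I_pos hy
    have hf : resolventMoment ν k (y * Complex.I) ≠ 0 := fun h0 => by
      have := hC _ hz
      rw [h0, zero_mul] at this
      exact hC0 this.symm
    have hf' := norm_ne_zero_iff.2 hf
    have h3 : ‖(y * Complex.I : ℂ)‖ = y := by simp [abs_of_pos hy]
    have h2 : ‖C‖ * ‖(y * Complex.I) ^ k * resolventMoment ν k (y * Complex.I)‖⁻¹ =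
        (‖expLogPotential α (y * Complex.I)‖ / y) ^ k := by
      rw [← hC _ hz, norm_mul, norm_mul, norm_pow, norm_pow, h3, div_pow]
      field_simp
    rw [h2, Real.pow_rpow_inv_natCast (by positivity) hk.ne']

lemma isCauchyOrDirac_of_succ (hα : FT α) {ν : Measure ℝ} [IsProbabilityMeasure ν] {n : ℕ}
    (hn : ∀ z : ℂ, 0 < z.im →
      resolventMoment ν (n + 1) z = resolventMoment ν n z * resolventMoment α 1 z)
    (hm : ∀ z : ℂ, 0 < z.im →
      resolventMoment ν (n + 2) z = resolventMoment ν (n + 1) z * resolventMoment α 1 z) :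
    IsCauchyOrDirac α := by
  obtain ⟨C, hC0, hC⟩ := exists_resolventMoment_mul_pow_eq hα hn
  obtain ⟨D, -, hD⟩ := exists_resolventMoment_mul_pow_eq hα hm
  refine isCauchyOrDirac_of_mul_eq_const hα (c := D / C) fun z hz => ?_
  rw [eq_div_iff hC0, ← hD z hz, ← hC z hz, hn z hz]
  ring

lemma isCauchyOrDirac_of_succ_succ (hα : FT α) {ν : Measure ℝ} [IsProbabilityMeasure ν] {n : ℕ}
    (hpos : 0 < n)
    (hn : ∀ z : ℂ, 0 < z.im →
      resolventMoment ν (n + 1) z = resolventMoment ν n z * resolventMoment α 1 z)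
    (hm : ∀ z : ℂ, 0 < z.im →
      resolventMoment ν (n + 3) z = resolventMoment ν (n + 2) z * resolventMoment α 1 z) :
    IsCauchyOrDirac α := by
  have := hα.1
  obtain ⟨C, hC0, hC⟩ := exists_resolventMoment_mul_pow_eq hα hn
  obtain ⟨D, -, hD⟩ := exists_resolventMoment_mul_pow_eq hα hm
  set p := expLogPotential α
  set S := resolventMoment α 1
  have hp0 (z : ℂ) : p z ≠ 0 := expLogPotential_ne_zero z
  have hpd (z : ℂ) (hz : 0 < z.im) : HasDerivAt p (-(S z * p z)) z :=
    hasDerivAt_expLogPotential hα hz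
  set S' : ℂ → ℂ := fun z => (1 : ℕ) * resolventMoment α 2 z
  have hSd (z : ℂ) (hz : 0 < z.im) : HasDerivAt S (S' z) z := hasDerivAt_resolventMoment hz 1
  set q : ℂ → ℂ := fun z => S z * p z with hq
  have hqd (z : ℂ) (hz : 0 < z.im) : HasDerivAt q (S' z * p z + S z * -(S z * p z)) z :=
    (hSd z hz).mul (hpd z hz)
  -- The second order equation satisfied by `p`.
  have hode (z : ℂ) (hz : 0 < z.im) :
      p z * (S' z * p z + S z * -(S z * p z)) = (n + 1) * (D / C - q z ^ 2) := by
    -- Two derivatives of R_{n+1} are compared: its own formula, and the product rule applied to R_n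
    -- S.
    have h1 : ((n + 1 : ℕ) : ℂ) * resolventMoment ν (n + 2) z =
        n * resolventMoment ν (n + 1) z * S z + resolventMoment ν n z * S' z := by
      refine (hasDerivAt_resolventMoment (ν := ν) hz (n + 1)).unique ?_
      refine ((hasDerivAt_resolventMoment (ν := ν) hz n).fun_mul (hSd z hz)).congr_of_eventuallyEq ?_
      filter_upwards [isOpen_upperHalf.mem_nhds hz] with x hx using hn x hx
    rw [hn z hz] at h1
    have hCz := hC z hz
    have hDz := hD z hz
    have hf : resolventMoment ν n z ≠ 0 := fun h0 => hC0 (by rw [← hCz, h0, zero_mul])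
    have h2 : D / C * resolventMoment ν n z = resolventMoment ν (n + 2) z * p z ^ 2 := by
      rw [div_mul_eq_mul_div, div_eq_iff hC0, ← hCz, ← hDz]
      ring
    apply mul_left_cancel₀ hf
    simp only [hq]
    push_cast at h1
    linear_combination (-(p z ^ 2)) * h1 - (n + 1) * h2
  -- The first integral.
  obtain ⟨K, hK⟩ := exists_eq_const_of_hasDerivAt_zero
    (g := fun z => (q z ^ 2 - D / C) * ((p z)⁻¹) ^ (2 * n + 2)) fun z hz => by
      refine ((((hqd z hz).fun_pow 2).sub_const _).fun_mul
        (((hpd z hz).fun_inv (hp0 z)).fun_pow (2 * n + 2))).congr_deriv ?_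
      have hI := mul_inv_cancel₀ (hp0 z)
      have hd : -(-(S z * p z)) / p z ^ 2 = q z * (p z)⁻¹ ^ 2 := by
        rw [neg_neg, div_eq_mul_inv, inv_pow]
      have h := hode z hz
      rw [hd]
      set I := (p z)⁻¹
      set Q := S' z * p z + S z * -(S z * p z)
      simp only [show 2 * n + 2 - 1 = 2 * n + 1 by omega]
      push_cast
      linear_combination 2 * q z * I ^ (2 * n + 3) * h - 2 * q z * Q * I ^ (2 * n + 2) * hI
  -- Along the imaginary axis |p| grows linearly while q stays bounded, so the first integral tends
  -- to 0.
  have hK0 : K = 0 := by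
    obtain ⟨L, hL0, hL⟩ := tendsto_norm_expLogPotential_div hα hpos hn
    have hpinf : Tendsto (fun y : ℝ => ‖p (y * Complex.I)‖) atTop atTop := by
      refine (hL.pos_mul_atTop hL0 tendsto_id).congr' ?_
      filter_upwards [eventually_gt_atTop 0] with y hy
      exact div_mul_cancel₀ _ hy.ne'
    have hqL : Tendsto (fun y : ℝ => ‖q (y * Complex.I)‖) atTop (𝓝 (1 * L)) := by
      have h1 := (tendsto_resolventMoment_atTop (ν := α) 1).norm
      simp only [pow_one, norm_neg, norm_one] at h1
      refine (h1.mul hL).congr' ?_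
      filter_upwards [eventually_gt_atTop 0] with y hy
      have h3 : ‖(y * Complex.I : ℂ)‖ = y := by simp [abs_of_pos hy]
      change _ = ‖S (y * Complex.I) * p (y * Complex.I)‖
      rw [norm_mul (_ * _), h3, norm_mul]
      field_simp
      rfl
    have hlim := ((hqL.pow 2).add_const ‖D / C‖).mul
      ((tendsto_inv_atTop_zero.comp hpinf).pow (2 * n + 2))
    rw [zero_pow (by omega), mul_zero] at hlim
    refine norm_le_zero_iff.1 (ge_of_tendsto hlim ?_)
    filter_upwards [eventually_gt_atTop 0] with y hy
    rw [← hK _ (im_ofReal_mul_I_pos hy), norm_mul, norm_pow, norm_inv]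
    refine mul_le_mul_of_nonneg_right ((norm_sub_le _ _).trans ?_) (by positivity)
    rw [norm_pow]
  have hq2 (z : ℂ) (hz : 0 < z.im) : q z ^ 2 = D / C := by
    have := hK z hz
    rw [hK0] at this
    exact sub_eq_zero.1 ((mul_eq_zero.1 this).resolve_right (pow_ne_zero _ (inv_ne_zero (hp0 z))))
  -- Feeding q² = D / C back into the equation gives p q' = 0, so no branch of a square root has to
  -- be chosen.
  obtain ⟨c, hc⟩ := exists_eq_const_of_hasDerivAt_zero (g := q) fun z hz => by
    refine (hqd z hz).congr_deriv ?_
    have := hode z hz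
    rw [hq2 z hz, sub_self, mul_zero] at this
    exact (mul_eq_zero.1 this).resolve_left (hp0 z)
  exact isCauchyOrDirac_of_mul_eq_const hα hc

end potential

end DirichletCurve

theorem proposition6p2 (α : Measure ℝ) (hα : DirichletCurve.FT α) (n m : ℕ) (hn : 0 < n)
    (hnm : n < m)
    (heq : DirichletCurve.dirichletMean (n : ℝ) α = DirichletCurve.dirichletMean (m : ℝ) α) :
    (∀ z : ℂ, 0 < z.im →
      (iteratedDeriv (n - 1) (DirichletCurve.stieltjes (DirichletCurve.dirichletMean (n : ℝ) α)) z /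
          ((n - 1).factorial : ℂ)) ^ m =
        (iteratedDeriv (m - 1) (DirichletCurve.stieltjes (DirichletCurve.dirichletMean (n : ℝ) α)) z /
          ((m - 1).factorial : ℂ)) ^ n) ∧
    (m = n + 1 ∨ m = n + 2 → DirichletCurve.IsCauchyOrDirac α) := by
  have := hα.1
  have : NeZero n := ⟨hn.ne'⟩
  have : NeZero m := ⟨(hn.trans hnm).ne'⟩
  have := DirichletCurve.isProbabilityMeasure_dirichletMean (n := n) hα
  have h1 (z : ℂ) (hz : 0 < z.im) :=
    DirichletCurve.resolventMoment_dirichletMean_succ (n := n) hα hz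
  have h2 (z : ℂ) (hz : 0 < z.im) :=
    DirichletCurve.resolventMoment_dirichletMean_succ (n := m) hα hz
  -- Both recursions now concern the same measure.
  simp only [← heq] at h2
  refine ⟨fun z hz => ?_, ?_⟩
  · have h3 (k : ℕ) (hk : 0 < k) :
        iteratedDeriv (k - 1) (DirichletCurve.stieltjes (DirichletCurve.dirichletMean n α)) z /
          ((k - 1).factorial : ℂ) =
        DirichletCurve.resolventMoment (DirichletCurve.dirichletMean n α) k z := by
      rw [DirichletCurve.iteratedDeriv_stieltjes _ hz, Nat.sub_add_cancel hk,
        mul_div_cancel_left₀ _ (by exact_mod_cast Nat.factorial_ne_zero _)]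
    rw [h3 n hn, h3 m (hn.trans hnm)]
    exact DirichletCurve.resolventMoment_pow_eq_pow hα h1 h2 hz
  · rintro (rfl | rfl)
    · exact DirichletCurve.isCauchyOrDirac_of_succ hα h1 h2
    · exact DirichletCurve.isCauchyOrDirac_of_succ_succ hα hn h1 h2
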